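/- Let $T$ be the torus with one open disc removed, let $h\colon T\to T$ be a homeomorphism that fixes $\partial T$ pointwise, and let $M = T\times[0,1]/\big((p,1)\sim(h(p),0)\big)$ be the untwisted punctured torus bundle with monodromy $h$. Suppose that $M$ is hyperbolic, i.e. that $h$ is of (pseudo-)Anosov type: the map $h_+\in \mathrm{SL}(2,\mathbb{Z})$ induced by $h$ on $H_1(T;\mathbb{Z})\cong\mathbb{Z}^2$ satisfies $|\operatorname{tr} h_+|>2$. Take a base point $x\in\partial T\times\{0\}$, and let $G\le \pi_1(M,x)$ be the fundamental group of the fibre $T\times\{0\}$, so that $\pi_1(M)\cong G\rtimes_{h_*}\mathbb{Z}$. Put $G_2=[G,G]$ and $G_3=[G_2,G]$. Let $<$ be a bi-order of $\pi_1(M)$ (a strict total order invariant under left and right multiplication), and let $<_2$ be the bi-order that it induces on $G_2$. A subgroup $C$ of $G_2$ is convex if $a<_2 g<_2 b$ with $a,b\in C$ and $g\in G_2$ implies $g\in C$; it is a maximal convex subgroup if it is convex and proper and the only convex subgroups of $G_2$ that contain it are $C$ and $G_2$. If $C$ is a maximal convex subgroup of $G_2$ with respect to $<_2$, then $C=G_3$.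 -/

import Mathlib

/-! ### Bi-orders and convex subgroups -/

/-- A bi-order of a group: a strict total order of its elements that is invariant under left and
right multiplication. -/
structure IsBiOrder {Γ : Type*} [Group Γ] (lt : Γ → Γ → Prop) : Prop where
  irrefl : ∀ a, ¬ lt a a
  trans : ∀ a b c, lt a b → lt b c → lt a c
  total : ∀ a b, lt a b ∨ a = b ∨ lt b a
  mul_left : ∀ g a b, lt a b → lt (g * a) (g * b)
  mul_right : ∀ g a b, lt a b → lt (a * g) (b * g)

/-- The order that an order of `Γ` induces on a subgroup. -/
def inducedOrder {Γ : Type*} [Group Γ] (lt : Γ → Γ → Prop) (H : Subgroup Γ) : H → H → Prop :=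
  fun a b => lt (a : Γ) (b : Γ)

/-- A subgroup `C` is convex if `a < g < b` with `a, b ∈ C` implies `g ∈ C`. -/
def IsConvexSubgroup {Γ : Type*} [Group Γ] (lt : Γ → Γ → Prop) (C : Subgroup Γ) : Prop :=
  ∀ a ∈ C, ∀ b ∈ C, ∀ g : Γ, lt a g → lt g b → g ∈ C

/-- A convex subgroup is maximal if it is proper and the only convex subgroups that contain it are
itself and the whole group. -/
def IsMaximalConvexSubgroup {Γ : Type*} [Group Γ] (lt : Γ → Γ → Prop) (C : Subgroup Γ) : Prop :=
  IsConvexSubgroup lt C ∧ C ≠ ⊤ ∧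
    ∀ D : Subgroup Γ, IsConvexSubgroup lt D → C ≤ D → D = C ∨ D = ⊤

/-! ### Punctured torus bundles -/

/-- The torus with one boundary component: `(ℝ/ℤ)²` with the open disc
`{(s, t) | |s| < 1/4 and |t| < 1/4}` removed. The norm of `ℝ/ℤ` is the distance to `0`, and the
product carries the maximum norm. -/
abbrev PuncturedTorus : Type :=
  {p : UnitAddCircle × UnitAddCircle // 1 / 4 ≤ ‖p‖}

/-- The boundary circle of the punctured torus. -/
def PuncturedTorus.boundary : Set PuncturedTorus :=
  {p | ‖p.1‖ = 1 / 4}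

/-- The bundle over the circle with fibre the punctured torus and monodromy `h`: the quotient space
of `T × [0, 1]` by `(p, 1) ∼ (h p, 0)`. -/
abbrev PuncturedTorusBundle (h : PuncturedTorus ≃ₜ PuncturedTorus) : Type :=
  Quot fun a b : PuncturedTorus × unitInterval => a.2 = 1 ∧ b = (h a.1, 0)

/-- The inclusion of the punctured torus as the fibre at height `0`. -/
def fibreInclusion (h : PuncturedTorus ≃ₜ PuncturedTorus) :
    C(PuncturedTorus, PuncturedTorusBundle h) where
  toFun p := Quot.mk _ (p, 0)
  continuous_toFun := continuous_quot_mk.comp (by fun_prop)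

/-- The subgroup `G` of `π₁(M)` in `π₁(M) = G ⋊ ℤ`: the fundamental group of the fibre, viewed
inside `π₁(M)` through the inclusion. -/
noncomputable def fibreGroup (h : PuncturedTorus ≃ₜ PuncturedTorus) (x : PuncturedTorus) :
    Subgroup (FundamentalGroup (PuncturedTorusBundle h) (fibreInclusion h x)) :=
  (FundamentalGroup.map (fibreInclusion h) x).range

/-- First integral homology of the punctured torus, as the abelianized fundamental group. -/
abbrev PuncturedTorus.H1 (x : PuncturedTorus) : Type :=
  Additive (Abelianization (FundamentalGroup PuncturedTorus x))

/-- The map `h₊` that `h` induces on first homology, for a base point fixed by `h`. -/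
noncomputable def homologyMap (h : PuncturedTorus ≃ₜ PuncturedTorus) {x : PuncturedTorus}
    (hx : h x = x) : PuncturedTorus.H1 x →ₗ[ℤ] PuncturedTorus.H1 x :=
  (MonoidHom.toAdditive (Abelianization.map
    (FundamentalGroup.mapOfEq (h : C(PuncturedTorus, PuncturedTorus)) hx))).toIntLinearMap

/-- The bundle with monodromy `h` is hyperbolic: `h` is of (pseudo-)Anosov type, that is, the
element `h₊` of `SL(2, ℤ)` by which it acts on `H₁(T; ℤ) ≅ ℤ²` satisfies `|tr h₊| > 2`. -/
def IsHyperbolicMonodromy (h : PuncturedTorus ≃ₜ PuncturedTorus) {x : PuncturedTorus}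
    (hx : h x = x) : Prop :=
  2 < |LinearMap.trace ℤ (PuncturedTorus.H1 x) (homologyMap h hx)|

/-!
Since `C` is maximal convex, Hölder's theorem provides a homomorphism `φ : G₂ → ℝ` that is
nonnegative on positive elements and has kernel `C`: fix `u > 1` outside `C`, let `m g` be the
exponent of the largest power of `u` below `g`, and put `φ g = lim m (gⁿ) / n`. Conjugation by an
element of `π₁(M)` preserves the order of `G₂`, so it multiplies `φ` by a positive scalar `exp Λ`,
where `Λ : π₁(M) → ℝ` is a homomorphism. On `G`, the homomorphism `Λ` factors through `H₁(T)` and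
is invariant under `h₊`, because `h₊` is conjugation by the stable letter. As `1` is not an
eigenvalue of `h₊`, `Λ` vanishes on `G`, and so `G₃ ≤ C`. On the other hand `π₁(T)` is generated by
two elements, so `G₂ / G₃` is cyclic; a proper convex subgroup contains every root of its elements,
hence cannot lie strictly between `G₃` and `G₂`.

That `π₁(T)` has two generators is read off the covering plane: cut along the edges of the
fundamental square, the punctured torus becomes star-shaped, and a loop only picks up a generator
where it crosses an edge.
-/

open scoped commutatorElement
open CategoryTheory Set Filter Topology

/-! ### Hölder's theorem for maximal convex subgroups -/

theorem eq_mul_of_nonneg_of_pos {A : Type*} [AddGroup A] {φ ψ : A →+ ℝ}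
    (h : ∀ g, 0 < φ g → 0 ≤ ψ g) {u : A} (hu : φ u = 1) (g : A) : ψ g = ψ u * φ g := by
  have hle : ∀ g, ψ u * φ g ≤ ψ g := fun g => by
    by_contra! hlt
    obtain ⟨n, hn⟩ := exists_lt_nsmul (sub_pos.mpr hlt) (ψ u)
    have hfloor : 0 < φ (n • g - (⌈n • φ g⌉ - 1) • u) := by
      simpa [hu] using sub_lt_iff_lt_add.mpr (Int.ceil_lt_add_one (n • φ g))
    have hψ := h _ hfloor
    have hceil := mul_le_mul_of_nonneg_right (Int.le_ceil (n • φ g)) (h u (by simp [hu]))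
    simp only [map_sub, map_nsmul, map_zsmul, nsmul_eq_mul, zsmul_eq_mul, Int.cast_sub,
      Int.cast_one] at hψ hceil hn
    linarith
  refine le_antisymm ?_ (hle g)
  simpa using hle (-g)

theorem exists_scaling_character {K : Type*} [Group K] [LinearOrder K] [MulLeftMono K]
    {φ : Additive K →+ ℝ} (hφ : ∀ g : K, 1 ≤ g → 0 ≤ φ (.ofMul g)) (hone : ∃ u, φ u = 1)
    {N : Type*} [Group N] (ρ : N →* MulAut K) (hρ : ∀ n, StrictMono (ρ n)) :
    ∃ Λ : Additive N →+ ℝ,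
      ∀ n k, φ (.ofMul (ρ n k)) = Real.exp (Λ (.ofMul n)) * φ (.ofMul k) := by
  obtain ⟨u, hu⟩ := hone
  have hpos : ∀ g : Additive K, 0 < φ g → 1 ≤ g.toMul := fun g hg => by
    by_contra! h
    have := hφ g.toMul⁻¹ (one_le_inv'.mpr h.le)
    rw [ofMul_inv, ofMul_toMul, map_neg] at this
    linarith
  have hnonneg : ∀ n (g : Additive K), 0 < φ g → 0 ≤ φ (.ofMul (ρ n g.toMul)) := fun n g hg =>
    hφ _ (map_one (ρ n) ▸ (hρ n).monotone (hpos g hg))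
  have hscale : ∀ n k, φ (.ofMul (ρ n k)) = φ (.ofMul (ρ n u.toMul)) * φ (.ofMul k) := fun n k =>
    eq_mul_of_nonneg_of_pos (ψ := φ.comp (MonoidHom.toAdditive (ρ n).toMonoidHom))
      (hnonneg n) hu (.ofMul k)
  have hne : ∀ n, φ (.ofMul (ρ n u.toMul)) ≠ 0 := fun n h0 => by
    have := hscale n ((ρ n).symm u.toMul)
    rw [MulEquiv.apply_symm_apply, ofMul_toMul, hu, h0, zero_mul] at this
    exact one_ne_zero this
  refine ⟨AddMonoidHom.mk' (fun n => Real.log (φ (.ofMul (ρ n.toMul u.toMul)))) fun m n => ?_,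
    fun n k => ?_⟩
  · rw [← Real.log_mul (hne _) (hne _), toMul_add, map_mul, MulAut.mul_apply, hscale]
  · rw [hscale, AddMonoidHom.mk'_apply, toMul_ofMul,
      Real.exp_log (lt_of_le_of_ne (hnonneg n u (by simp [hu])) (hne n).symm)]

section OrderedGroup

variable {K : Type*} [Group K] [LinearOrder K]

theorem IsConvexSubgroup.mem_of_one_le {C : Subgroup K} (hC : IsConvexSubgroup (· < ·) C) {g c : K}
    (hc : c ∈ C) (h1 : 1 ≤ g) (h2 : g ≤ c) : g ∈ C := by
  rcases h1.eq_or_lt with rfl | h1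
  · exact one_mem C
  rcases h2.eq_or_lt with rfl | h2
  · exact hc
  exact hC 1 (one_mem C) c hc g h1 h2

theorem IsConvexSubgroup.lt_of_mem_of_notMem {C : Subgroup K} (hC : IsConvexSubgroup (· < ·) C)
    {c u : K} (hc : c ∈ C) (hu : 1 ≤ u) (huC : u ∉ C) : c < u :=
  lt_of_not_ge fun h => huC (hC.mem_of_one_le hc hu h)

/-- `m` assigns to each `g` the exponent of the largest power of `u` that is at most `g`. -/
def IsPowFloor (u : K) (m : K → ℤ) : Prop :=
  ∀ g, u ^ m g ≤ g ∧ g < u ^ (m g + 1)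

variable [MulLeftMono K]

theorem IsConvexSubgroup.mem_of_pow_mem {C : Subgroup K} (hC : IsConvexSubgroup (· < ·) C) {g : K}
    {n : ℕ} (hn : n ≠ 0) (hg : g ^ n ∈ C) : g ∈ C := by
  wlog h : 1 ≤ g generalizing g
  · exact inv_mem_iff.mp (this (by rw [inv_pow]; exact inv_mem hg)
      (one_le_inv'.mpr (le_of_not_ge h)))
  exact hC.mem_of_one_le hg h (le_self_pow h hn)

theorem IsConvexSubgroup.mem_of_zpow_mem {C : Subgroup K} (hC : IsConvexSubgroup (· < ·) C) {g : K}
    {n : ℤ} (hn : n ≠ 0) (hg : g ^ n ∈ C) : g ∈ C := by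
  refine hC.mem_of_pow_mem (Int.natAbs_ne_zero.mpr hn) ?_
  rcases abs_choice n with h | h
  · rwa [← zpow_natCast, Int.natCast_natAbs, h]
  · rwa [← zpow_natCast, Int.natCast_natAbs, h, zpow_neg, inv_mem_iff]

theorem IsMaximalConvexSubgroup.exists_one_lt_notMem {C : Subgroup K}
    (hC : IsMaximalConvexSubgroup (· < ·) C) : ∃ u, 1 < u ∧ u ∉ C := by
  obtain ⟨g, -, hg⟩ := SetLike.exists_of_lt (lt_top_iff_ne_top.mpr hC.2.1)
  rcases lt_trichotomy 1 g with h | rfl | h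
  · exact ⟨g, h, hg⟩
  · exact absurd (one_mem C) hg
  · exact ⟨g⁻¹, one_lt_inv'.mpr h, by rwa [inv_mem_iff]⟩

theorem IsConvexSubgroup.eq_of_sup_zpowers_eq_top {C D : Subgroup K} [D.Normal]
    (hC : IsConvexSubgroup (· < ·) C) (hne : C ≠ ⊤) (hDC : D ≤ C) {c : K}
    (hc : D ⊔ Subgroup.zpowers c = ⊤) : C = D := by
  have hcC : c ∉ C := fun h =>
    hne (top_le_iff.mp (hc ▸ sup_le hDC ((Subgroup.zpowers_le).mpr h)))
  refine le_antisymm (fun g hg => ?_) hDC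
  obtain ⟨d, hd, _, ⟨m, rfl⟩, rfl⟩ :=
    Subgroup.mem_sup_of_normal_left.mp (hc ▸ Subgroup.mem_top g : g ∈ D ⊔ Subgroup.zpowers c)
  have hm : m = 0 := by
    by_contra hm
    exact hcC (hC.mem_of_zpow_mem hm ((Subgroup.mul_mem_cancel_left C (hDC hd)).mp hg))
  simpa [hm] using hd

theorem zpow_strictMono_of_one_lt {u : K} (hu : 1 < u) : StrictMono fun m : ℤ => u ^ m :=
  strictMono_int_of_lt_succ fun m => by
    rw [zpow_add_one]
    exact lt_mul_of_one_lt_right' _ hu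

namespace IsPowFloor

variable {u : K} {m : K → ℤ}

theorem le_of_zpow_le (hm : IsPowFloor u m) (hu : 1 < u) {k : ℤ} {g : K} (h : u ^ k ≤ g) :
    k ≤ m g :=
  Int.lt_add_one_iff.mp ((zpow_strictMono_of_one_lt hu).lt_iff_lt.mp (h.trans_lt (hm g).2))

theorem lt_of_lt_zpow (hm : IsPowFloor u m) (hu : 1 < u) {k : ℤ} {g : K} (h : g < u ^ k) :
    m g < k :=
  (zpow_strictMono_of_one_lt hu).lt_iff_lt.mp ((hm g).1.trans_lt h)

theorem monotone (hm : IsPowFloor u m) (hu : 1 < u) : Monotone m := fun g _ h =>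
  hm.le_of_zpow_le hu ((hm g).1.trans h)

theorem apply_pow_self (hm : IsPowFloor u m) (hu : 1 < u) (n : ℕ) : m (u ^ n) = n := by
  refine le_antisymm (Int.lt_add_one_iff.mp (hm.lt_of_lt_zpow hu ?_))
    (hm.le_of_zpow_le hu (zpow_natCast u n).le)
  rw [← zpow_natCast]
  exact zpow_strictMono_of_one_lt hu (lt_add_one _)

end IsPowFloor

variable [MulRightMono K]

theorem pow_mul_le_mul_pow {g h : K} (hgh : g * h ≤ h * g) (n : ℕ) : g ^ n * h ≤ h * g ^ n := by
  induction n with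
  | zero => simp
  | succ n ih =>
    calc g ^ (n + 1) * h = g ^ n * (g * h) := by rw [pow_succ, mul_assoc]
      _ ≤ g ^ n * h * g := by rw [mul_assoc]; gcongr
      _ ≤ h * g ^ n * g := by gcongr
      _ = h * g ^ (n + 1) := by rw [pow_succ, mul_assoc]

theorem pow_mul_pow_le_mul_pow {g h : K} (hgh : g * h ≤ h * g) (n : ℕ) :
    g ^ n * h ^ n ≤ (g * h) ^ n := by
  induction n with
  | zero => simp
  | succ n ih =>
    calc g ^ (n + 1) * h ^ (n + 1) = g * (g ^ n * h) * h ^ n := by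
          simp only [pow_succ', mul_assoc]
      _ ≤ g * (h * g ^ n) * h ^ n := by gcongr g * ?_ * _; exact pow_mul_le_mul_pow hgh n
      _ = g * h * (g ^ n * h ^ n) := by simp only [mul_assoc]
      _ ≤ g * h * (g * h) ^ n := by gcongr
      _ = (g * h) ^ (n + 1) := (pow_succ' _ _).symm

theorem mul_pow_le_pow_mul_pow {g h : K} (hgh : g * h ≤ h * g) (n : ℕ) :
    (h * g) ^ n ≤ h ^ n * g ^ n := by
  induction n with
  | zero => simp
  | succ n ih =>
    calc (h * g) ^ (n + 1) = (h * g) ^ n * (h * g) := pow_succ _ _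
      _ ≤ h ^ n * g ^ n * (h * g) := by gcongr
      _ = h ^ n * (g ^ n * h) * g := by simp only [mul_assoc]
      _ ≤ h ^ n * (h * g ^ n) * g := by gcongr _ * ?_ * g; exact pow_mul_le_mul_pow hgh n
      _ = h ^ (n + 1) * g ^ (n + 1) := by simp only [pow_succ, mul_assoc]

theorem exists_isPowFloor {u : K} (hu : 1 < u) (harch : ∀ g : K, ∃ n : ℕ, g ≤ u ^ n) :
    ∃ m : K → ℤ, IsPowFloor u m := by
  suffices h : ∀ g, ∃ k : ℤ, u ^ k ≤ g ∧ g < u ^ (k + 1) from ⟨_, fun g => (h g).choose_spec⟩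
  intro g
  obtain ⟨n, hn⟩ := harch g
  obtain ⟨k, hk⟩ := harch g⁻¹
  obtain ⟨m, hm, hmax⟩ := Int.exists_greatest_of_bdd (P := fun m : ℤ => u ^ m ≤ g)
    ⟨n, fun z hz => (zpow_strictMono_of_one_lt hu).le_iff_le.mp (by simpa using hz.trans hn)⟩
    ⟨-k, by simpa using inv_le_inv_iff.mpr hk⟩
  refine ⟨m, hm, not_le.mp fun h => ?_⟩
  have := hmax _ h
  lia

namespace IsPowFloor

variable {u : K} {m : K → ℤ}

theorem add_le_apply_mul (hm : IsPowFloor u m) (hu : 1 < u) (g h : K) : m g + m h ≤ m (g * h) :=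
  hm.le_of_zpow_le hu (by rw [zpow_add]; exact mul_le_mul' (hm g).1 (hm h).1)

theorem apply_mul_le (hm : IsPowFloor u m) (hu : 1 < u) (g h : K) :
    m (g * h) ≤ m g + m h + 1 := by
  have hlt : g * h < u ^ (m g + 1 + (m h + 1)) := by
    rw [zpow_add]
    exact mul_lt_mul_of_lt_of_lt (hm g).2 (hm h).2
  have := hm.lt_of_lt_zpow hu hlt
  lia

theorem nsmul_le_apply_pow (hm : IsPowFloor u m) (hu : 1 < u) (g : K) (n : ℕ) :
    n * m g ≤ m (g ^ n) :=
  hm.le_of_zpow_le hu (by rw [mul_comm, zpow_mul, zpow_natCast]; exact pow_le_pow_left' (hm g).1 n)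

/-- If `gh ≤ hg`, then `(gh)ⁿ` lies between `gⁿhⁿ` and `hⁿgⁿ`, which have nearly the same floor. -/
theorem abs_apply_mul_pow_sub_le_one (hm : IsPowFloor u m) (hu : 1 < u) (g h : K) (n : ℕ) :
    |m ((g * h) ^ n) - (m (g ^ n) + m (h ^ n))| ≤ 1 := by
  have sandwich : ∀ {a b c : K}, a * b ≤ c → c ≤ b * a →
      m a + m b ≤ m c ∧ m c ≤ m a + m b + 1 := fun {a b _} h₁ h₂ =>
    ⟨(hm.add_le_apply_mul hu a b).trans (hm.monotone hu h₁),
      (hm.monotone hu h₂).trans ((hm.apply_mul_le hu b a).trans (by lia))⟩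
  rw [abs_le]
  rcases le_total (g * h) (h * g) with hgh | hgh
  · have := sandwich (pow_mul_pow_le_mul_pow hgh n)
      ((pow_le_pow_left' hgh n).trans (mul_pow_le_pow_mul_pow hgh n))
    lia
  · have := sandwich ((pow_mul_pow_le_mul_pow hgh n).trans (pow_le_pow_left' hgh n))
      (mul_pow_le_pow_mul_pow hgh n)
    lia

theorem exists_tendsto_div (hm : IsPowFloor u m) (hu : 1 < u) (g : K) :
    ∃ r : ℝ, Tendsto (fun n : ℕ => (m (g ^ n) : ℝ) / n) atTop (𝓝 r) := by
  have hsub : Subadditive fun n : ℕ => (m (g ^ n) : ℝ) + 1 := fun k n => by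
    have := hm.apply_mul_le hu (g ^ k) (g ^ n)
    rw [← pow_add] at this
    have : (m (g ^ (k + n)) : ℝ) ≤ m (g ^ k) + m (g ^ n) + 1 := by exact_mod_cast this
    linarith
  have hbdd : BddBelow (range fun n : ℕ => ((m (g ^ n) : ℝ) + 1) / n) := by
    refine ⟨min 0 (m g), ?_⟩
    rintro _ ⟨n, rfl⟩
    rcases n.eq_zero_or_pos with rfl | hn
    · simp
    · have : (n : ℝ) * m g ≤ m (g ^ n) := by exact_mod_cast hm.nsmul_le_apply_pow hu g n
      refine (min_le_right _ _).trans ((le_div_iff₀ (by positivity)).mpr ?_)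
      linarith
  refine ⟨hsub.lim, ?_⟩
  have := (hsub.tendsto_lim hbdd).sub tendsto_one_div_atTop_nhds_zero_nat
  simpa only [add_div, add_sub_cancel_right, sub_zero] using this

end IsPowFloor

theorem exists_addMonoidHom_real_of_forall_le_pow {u : K} (hu : 1 < u)
    (harch : ∀ g : K, ∃ n : ℕ, g ≤ u ^ n) :
    ∃ φ : Additive K →+ ℝ, φ (.ofMul u) = 1 ∧ ∀ g : K, 1 ≤ g → 0 ≤ φ (.ofMul g) := by
  obtain ⟨m, hm⟩ := exists_isPowFloor hu harch
  choose φ hφ using hm.exists_tendsto_div hu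
  have hmul : ∀ g h, φ (g * h) = φ g + φ h := fun g h => by
    refine eq_of_sub_eq_zero (tendsto_nhds_unique ((hφ (g * h)).sub ((hφ g).add (hφ h))) ?_)
    refine squeeze_zero_norm (fun n => ?_) tendsto_one_div_atTop_nhds_zero_nat
    rw [← add_div, ← sub_div, norm_div, Real.norm_natCast, Real.norm_eq_abs]
    gcongr
    exact_mod_cast hm.abs_apply_mul_pow_sub_le_one hu g h n
  refine ⟨AddMonoidHom.mk' (fun g => φ g.toMul) fun g h => hmul g.toMul h.toMul, ?_, fun g hg => ?_⟩
  · refine tendsto_nhds_unique (hφ u) (tendsto_const_nhds.congr' ?_)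
    filter_upwards [eventually_ne_atTop 0] with n hn
    rw [hm.apply_pow_self hu, Int.cast_natCast, div_self (Nat.cast_ne_zero.mpr hn)]
  · refine ge_of_tendsto' (hφ g) fun n => div_nonneg ?_ n.cast_nonneg
    exact_mod_cast hm.le_of_zpow_le hu (k := 0) (by simpa using one_le_pow_of_one_le' hg n)

/-- The subgroup of the elements bounded above and below by powers of `u`. If `1 ≤ u`, it is the
smallest convex subgroup that contains `u`. -/
def powBounded (u : K) : Subgroup K where
  carrier := {g | ∃ n : ℕ, g ≤ u ^ n ∧ g⁻¹ ≤ u ^ n}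
  one_mem' := ⟨0, by simp⟩
  mul_mem' := by
    rintro a b ⟨m, hm, hm'⟩ ⟨n, hn, hn'⟩
    refine ⟨m + n, pow_add u m n ▸ mul_le_mul' hm hn, ?_⟩
    rw [mul_inv_rev, add_comm, pow_add]
    exact mul_le_mul' hn' hm'
  inv_mem' := fun ⟨n, hn, hn'⟩ => ⟨n, hn', by rwa [inv_inv]⟩

theorem isConvexSubgroup_powBounded {u : K} (hu : 1 ≤ u) :
    IsConvexSubgroup (· < ·) (powBounded u) := by
  rintro a ⟨m, -, ha⟩ b ⟨n, hb, -⟩ g hag hgb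
  refine ⟨m + n, (hgb.le.trans hb).trans (pow_le_pow_right' hu (Nat.le_add_left n m)), ?_⟩
  exact ((inv_le_inv_iff.mpr hag.le).trans ha).trans (pow_le_pow_right' hu (Nat.le_add_right m n))

namespace IsMaximalConvexSubgroup

variable {C : Subgroup K}

theorem exists_le_pow (hC : IsMaximalConvexSubgroup (· < ·) C) {u : K} (hu : 1 < u) (huC : u ∉ C)
    (g : K) : ∃ n : ℕ, g ≤ u ^ n := by
  obtain ⟨hconv, -, hmax⟩ := hC
  have hCu : ∀ c ∈ C, c ≤ u ^ 1 := fun c hc =>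
    (hconv.lt_of_mem_of_notMem hc hu.le huC).le.trans_eq (pow_one u).symm
  have hle : C ≤ powBounded u := fun c hc => ⟨1, hCu c hc, hCu _ (inv_mem hc)⟩
  have hu_mem : u ∈ powBounded u := ⟨1, by simp, by simpa using (inv_le_one'.mpr hu.le).trans hu.le⟩
  rcases hmax _ (isConvexSubgroup_powBounded hu.le) hle with h | h
  · exact absurd (h ▸ hu_mem) huC
  · obtain ⟨n, hn, -⟩ : g ∈ powBounded u := h ▸ Subgroup.mem_top g
    exact ⟨n, hn⟩

theorem exists_addMonoidHom_real (hC : IsMaximalConvexSubgroup (· < ·) C) :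
    ∃ φ : Additive K →+ ℝ, (∃ u, φ u = 1) ∧ (∀ g : K, 1 ≤ g → 0 ≤ φ (.ofMul g)) ∧
      ∀ g : K, φ (.ofMul g) = 0 ↔ g ∈ C := by
  obtain ⟨u, hu, huC⟩ := hC.exists_one_lt_notMem
  obtain ⟨φ, hφu, hφ⟩ := exists_addMonoidHom_real_of_forall_le_pow hu (hC.exists_le_pow hu huC)
  have hmono : ∀ {g h : K}, g ≤ h → φ (.ofMul g) ≤ φ (.ofMul h) := fun {g h} hgh => by
    simpa using hφ (h / g) (one_le_div'.mpr hgh)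
  have hpos : ∀ g : K, 1 ≤ g → g ∉ C → φ (.ofMul g) ≠ 0 := fun g hg hgC h0 => by
    have hg1 : 1 < g := lt_of_le_of_ne hg fun h => hgC (h ▸ one_mem C)
    obtain ⟨n, hn⟩ := hC.exists_le_pow hg1 hgC u
    have := hmono hn
    rw [hφu, ofMul_pow, map_nsmul, h0, smul_zero] at this
    linarith
  have hle : ∀ g ∈ C, φ (.ofMul g) ≤ 0 := fun g hg => by
    by_contra! h
    obtain ⟨n, hn⟩ := exists_lt_nsmul h 1
    have := hmono (hC.1.lt_of_mem_of_notMem (pow_mem hg n) hu.le huC).le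
    rw [hφu, ofMul_pow, map_nsmul] at this
    linarith
  refine ⟨φ, ⟨_, hφu⟩, hφ, fun g => ⟨fun h0 => ?_, fun hg => (hle g hg).antisymm ?_⟩⟩
  · by_contra hgC
    rcases le_total 1 g with h | h
    · exact hpos g h hgC h0
    · exact hpos g⁻¹ (one_le_inv'.mpr h) (by rwa [inv_mem_iff])
        (by rw [ofMul_inv, map_neg, h0, neg_zero])
  · simpa using hle g⁻¹ (inv_mem hg)

end IsMaximalConvexSubgroup

end OrderedGroup

/-- The linear order underlying a bi-order. -/
noncomputable abbrev IsBiOrder.toLinearOrder {Γ : Type*} [Group Γ] {lt : Γ → Γ → Prop}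
    (hlt : IsBiOrder lt) : LinearOrder Γ :=
  have : IsStrictTotalOrder Γ lt :=
    { irrefl := hlt.irrefl
      trans := hlt.trans
      trichotomous := fun a b h h' => ((hlt.total a b).resolve_left h).resolve_right h' }
  have := Classical.decRel lt
  linearOrderOfSTO lt

namespace IsBiOrder

variable {Γ : Type*} [Group Γ] {lt : Γ → Γ → Prop}

theorem induced (hlt : IsBiOrder lt) (H : Subgroup Γ) : IsBiOrder (inducedOrder lt H) where
  irrefl a := hlt.irrefl a
  trans a b c := hlt.trans a b c
  total a b := (hlt.total a b).imp_right (.imp_left Subtype.ext)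
  mul_left g a b := hlt.mul_left g a b
  mul_right g a b := hlt.mul_right g a b

theorem mulLeftMono (hlt : IsBiOrder lt) : letI := hlt.toLinearOrder; MulLeftMono Γ :=
  letI := hlt.toLinearOrder
  ⟨fun g a b h => h.imp (congrArg (g * ·)) (hlt.mul_left g a b)⟩

theorem mulRightMono (hlt : IsBiOrder lt) : letI := hlt.toLinearOrder; MulRightMono Γ :=
  letI := hlt.toLinearOrder
  ⟨fun g a b h => h.imp (congrArg (· * g)) (hlt.mul_right g a b)⟩

end IsBiOrder

theorem IsMaximalConvexSubgroup.exists_normalizer_scaling {Γ : Type*} [Group Γ]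
    {lt : Γ → Γ → Prop} (hlt : IsBiOrder lt) {K : Subgroup Γ} {C : Subgroup K}
    (hC : IsMaximalConvexSubgroup (inducedOrder lt K) C) :
    ∃ (φ : Additive K →+ ℝ) (Λ : Additive (Subgroup.normalizer (K : Set Γ)) →+ ℝ),
      (∀ g : K, φ (.ofMul g) = 0 ↔ g ∈ C) ∧
      ∀ n k, φ (.ofMul (K.normalizerMonoidHom n k)) = Real.exp (Λ (.ofMul n)) * φ (.ofMul k) := by
  let _ := (hlt.induced K).toLinearOrder
  have := (hlt.induced K).mulLeftMono
  have := (hlt.induced K).mulRightMono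
  have hC' : IsMaximalConvexSubgroup (· < ·) C := hC
  obtain ⟨φ, hu, hφ, hker⟩ := hC'.exists_addMonoidHom_real
  obtain ⟨Λ, hΛ⟩ := exists_scaling_character hφ hu K.normalizerMonoidHom fun n _ _ hab =>
    hlt.mul_right _ _ _ (hlt.mul_left n _ _ hab)
  exact ⟨φ, Λ, hker, hΛ⟩

/-! ### Maximal convex subgroups of a commutator subgroup -/

section Commutator

variable {Γ : Type*} [Group Γ]

theorem commutator_closure_closure_le {S T : Set Γ} {N : Subgroup Γ}
    (hS : S ⊆ Subgroup.normalizer (N : Set Γ)) (hT : T ⊆ Subgroup.normalizer (N : Set Γ))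
    (h : ∀ s ∈ S, ∀ t ∈ T, ⁅s, t⁆ ∈ N) : ⁅Subgroup.closure S, Subgroup.closure T⁆ ≤ N := by
  -- Commuting with `g` modulo `N` is a subgroup condition on elements of the normalizer of `N`.
  have closure_left : ∀ {S : Set Γ}, S ⊆ Subgroup.normalizer (N : Set Γ) → ∀ {g : Γ},
      (∀ s ∈ S, ⁅s, g⁆ ∈ N) → ∀ x ∈ Subgroup.closure S, ⁅x, g⁆ ∈ N := fun {S} hS {g} hg x hx => by
    have hnorm : Subgroup.closure S ≤ Subgroup.normalizer (N : Set Γ) :=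
      (Subgroup.closure_le _).mpr hS
    induction hx using Subgroup.closure_induction with
    | mem x hx => exact hg x hx
    | one => simp
    | mul x y hx _ ihx ihy =>
      rw [commutatorElement_mul_left_eq_conj_mul]
      exact mul_mem ((hnorm hx _).mp ihy) ihx
    | inv x hx ih =>
      rw [commutatorElement_inv_left, ← commutatorElement_inv]
      simpa using (hnorm (inv_mem hx) _).mp (inv_mem ih)
  have hsymm : ∀ {x y : Γ}, ⁅x, y⁆ ∈ N → ⁅y, x⁆ ∈ N := fun hxy =>
    commutatorElement_inv (G := Γ) _ _ ▸ inv_mem hxy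
  exact Subgroup.commutator_le.mpr fun x hx y hy => hsymm <|
    closure_left hT (fun t ht => hsymm (closure_left hS (fun s hs => h s hs t ht) x hx)) y hy

theorem commutator_closure_pair_le_sup_zpowers {G : Subgroup Γ} {a b : Γ}
    (hG : Subgroup.closure {a, b} = G) :
    ⁅G, G⁆ ≤ ⁅⁅G, G⁆, G⁆ ⊔ Subgroup.zpowers ⁅a, b⁆ := by
  have ha : a ∈ G := hG ▸ Subgroup.subset_closure (by simp)
  have hb : b ∈ G := hG ▸ Subgroup.subset_closure (by simp)
  have hle : ⁅⁅G, G⁆, G⁆ ⊔ Subgroup.zpowers ⁅a, b⁆ ≤ ⁅G, G⁆ :=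
    sup_le (Subgroup.le_normalizer_iff_commutator_le_left.mp
      (Subgroup.normalizer_commutator_ge_left G G))
      (Subgroup.zpowers_le.mpr (Subgroup.commutator_mem_commutator ha hb))
  have hmem : ⁅a, b⁆ ∈ ⁅⁅G, G⁆, G⁆ ⊔ Subgroup.zpowers ⁅a, b⁆ :=
    Subgroup.mem_sup_right (Subgroup.mem_zpowers _)
  have hnorm : ({a, b} : Set Γ) ⊆
      Subgroup.normalizer ((⁅⁅G, G⁆, G⁆ ⊔ Subgroup.zpowers ⁅a, b⁆ : Subgroup Γ) : Set Γ) :=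
    (pair_subset ha hb).trans (Subgroup.le_normalizer_iff_commutator_le_left.mpr
      ((Subgroup.commutator_mono hle le_rfl).trans le_sup_left))
  conv_lhs => rw [← hG]
  refine commutator_closure_closure_le hnorm hnorm ?_
  rintro s (rfl | rfl) t (rfl | rfl)
  · simp
  · exact hmem
  · rw [← commutatorElement_inv t s, inv_mem_iff]
    exact hmem
  · simp

theorem normalizer_le_normalizer_commutator (G : Subgroup Γ) :
    Subgroup.normalizer (G : Set Γ) ≤ Subgroup.normalizer ((⁅G, G⁆ : Subgroup Γ) : Set Γ) :=
  fun n hn => by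
    rw [Subgroup.mem_normalizer_iff_map_conj_eq] at hn ⊢
    exact (Subgroup.map_commutator _ _ _).trans (congrArg₂ _ hn hn)

end Commutator

theorem IsMaximalConvexSubgroup.commutator_le_map_subtype {Γ : Type*} [Group Γ]
    {lt : Γ → Γ → Prop} (hlt : IsBiOrder lt) {K G : Subgroup Γ} {C : Subgroup K}
    (hC : IsMaximalConvexSubgroup (inducedOrder lt K) C)
    (hG : G ≤ Subgroup.normalizer (K : Set Γ))
    (hvanish : ∀ Λ : Additive (Subgroup.normalizer (K : Set Γ)) →+ ℝ, ∀ g (hg : g ∈ G),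
      Λ (.ofMul ⟨g, hG hg⟩) = 0) :
    ⁅K, G⁆ ≤ C.map K.subtype := by
  obtain ⟨φ, Λ, hker, hΛ⟩ := hC.exists_normalizer_scaling hlt
  refine Subgroup.commutator_le.mpr fun k hk g hg => ?_
  refine ⟨⟨k, hk⟩ / K.normalizerMonoidHom ⟨g, hG hg⟩ ⟨k, hk⟩, ?_, ?_⟩
  · refine (hker _).mp ?_
    rw [ofMul_div, map_sub, hΛ, hvanish Λ g hg, Real.exp_zero, one_mul, sub_self]
  · simp [commutatorElement_def, div_eq_mul_inv, mul_assoc]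

theorem IsMaximalConvexSubgroup.map_subtype_eq_commutator {Γ : Type*} [Group Γ]
    {lt : Γ → Γ → Prop} (hlt : IsBiOrder lt) {G : Subgroup Γ} {a b : Γ}
    (hab : Subgroup.closure {a, b} = G)
    (hvanish : ∀ Λ : Additive (Subgroup.normalizer (G : Set Γ)) →+ ℝ, ∀ g (hg : g ∈ G),
      Λ (.ofMul ⟨g, Subgroup.le_normalizer hg⟩) = 0)
    {C : Subgroup ↥⁅G, G⁆} (hC : IsMaximalConvexSubgroup (inducedOrder lt ⁅G, G⁆) C) :
    C.map ⁅G, G⁆.subtype = ⁅⁅G, G⁆, G⁆ := by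
  let _ := (hlt.induced ⁅G, G⁆).toLinearOrder
  have := (hlt.induced ⁅G, G⁆).mulLeftMono
  have hC' : IsMaximalConvexSubgroup (· < ·) C := hC
  have hG3 : ⁅⁅G, G⁆, G⁆ ≤ ⁅G, G⁆ := Subgroup.le_normalizer_iff_commutator_le_left.mp
    (Subgroup.normalizer_commutator_ge_left G G)
  have hle : ⁅⁅G, G⁆, G⁆ ≤ C.map ⁅G, G⁆.subtype := hC.commutator_le_map_subtype hlt
    (Subgroup.normalizer_commutator_ge_left G G) fun Λ g hg =>
      hvanish (Λ.comp (MonoidHom.toAdditive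
        (Subgroup.inclusion (normalizer_le_normalizer_commutator G)))) g hg
  have : (⁅⁅G, G⁆, G⁆.subgroupOf ⁅G, G⁆).Normal := Subgroup.normal_subgroupOf_of_le_normalizer
    (Subgroup.normalizer_commutator_ge_left ⁅G, G⁆ G)
  have hmem : ⁅a, b⁆ ∈ ⁅G, G⁆ := Subgroup.commutator_mem_commutator
    (hab ▸ Subgroup.subset_closure (by simp)) (hab ▸ Subgroup.subset_closure (by simp))
  have hcyclic : ⁅⁅G, G⁆, G⁆.subgroupOf ⁅G, G⁆ ⊔ Subgroup.zpowers ⟨⁅a, b⁆, hmem⟩ = ⊤ := by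
    apply Subgroup.map_injective ⁅G, G⁆.subtype_injective
    rw [Subgroup.map_sup, Subgroup.map_subgroupOf_eq_of_le hG3, MonoidHom.map_zpowers,
      ← MonoidHom.range_eq_map, Subgroup.range_subtype]
    exact le_antisymm (sup_le hG3 (Subgroup.zpowers_le.mpr hmem))
      (commutator_closure_pair_le_sup_zpowers hab)
  have hsub : ⁅⁅G, G⁆, G⁆.subgroupOf ⁅G, G⁆ ≤ C := by
    rwa [← Subgroup.map_subtype_le_map_subtype, Subgroup.map_subgroupOf_eq_of_le hG3]
  rw [hC'.1.eq_of_sup_zpowers_eq_top hC'.2.1 hsub hcyclic, Subgroup.map_subgroupOf_eq_of_le hG3]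

/-! ### Endomorphisms of the first homology -/

section Homology

theorem eq_zero_of_comp_eq_zero_of_injective {R M V : Type*} [CommRing R] [IsDomain R]
    [AddCommGroup M] [Module R M] [Module.Finite R M] [AddCommGroup V] [Module R V]
    [Module.IsTorsionFree R V] {f : M →ₗ[R] M} (hf : Function.Injective f) {ψ : M →ₗ[R] V}
    (h : ψ ∘ₗ f = 0) : ψ = 0 := by
  have hrank : Module.finrank R (M ⧸ LinearMap.range f) = 0 := by
    have := (LinearMap.range f).finrank_quotient_add_finrank
    rw [LinearMap.finrank_range_of_inj hf] at this
    lia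
  ext v
  obtain ⟨⟨r, hr⟩, hrv⟩ :=
    Module.finrank_eq_zero_iff_isTorsion.mp hrank (x := Submodule.Quotient.mk v)
  obtain ⟨w, hw⟩ := (Submodule.Quotient.mk_eq_zero _).mp hrv
  have : r • ψ v = 0 := by
    rw [← map_smul, ← show f w = r • v from hw]
    exact LinearMap.congr_fun h w
  exact (smul_eq_zero.mp this).resolve_left (nonZeroDivisors.ne_zero hr)

theorem eq_zero_of_comp_eq_self {A : Type*} [AddCommGroup A] [Module.Finite ℤ A] {e : A →ₗ[ℤ] A}
    (he : ¬ Module.End.HasEigenvalue e 1) {ψ : A →+ ℝ} (hψ : ∀ v, ψ (e v) = ψ v) : ψ = 0 := by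
  have hinj : Function.Injective (e - 1 : Module.End ℤ A) := by
    rw [Module.End.hasEigenvalue_iff, not_not, Module.End.eigenspace_def, one_smul] at he
    exact LinearMap.ker_eq_bot.mp he
  have : ψ.toIntLinearMap = 0 := eq_zero_of_comp_eq_zero_of_injective hinj <| by
    ext v
    simp [hψ]
  ext v
  exact LinearMap.congr_fun this v

theorem not_isRoot_charpoly_one_of_two_lt_abs_trace {n : ℕ} (hn : n ≤ 2)
    {M : Matrix (Fin n) (Fin n) ℤ} (hdet : IsUnit M.det) (htr : 2 < |M.trace|) :
    ¬ M.charpoly.IsRoot 1 := by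
  rw [Int.isUnit_iff] at hdet
  rw [lt_abs] at htr
  interval_cases n
  · simp at htr
  · simp only [Matrix.trace_fin_one, Matrix.det_fin_one] at htr hdet
    lia
  · intro h
    have : 1 - M.trace + M.det = 0 := by
      simpa [Matrix.charpoly_fin_two, Polynomial.IsRoot] using h
    lia

theorem not_hasEigenvalue_one_of_two_lt_abs_trace {A : Type*} [AddCommGroup A]
    (hA : Module.finrank ℤ A ≤ 2) {e : A →ₗ[ℤ] A} (he : Function.Surjective e)
    (htr : 2 < |LinearMap.trace ℤ A e|) : ¬ Module.End.HasEigenvalue e 1 := by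
  classical
  -- `LinearMap.trace` takes the junk value `0` on modules without a finite basis.
  have hbasis : ∃ s : Finset A, Nonempty (Module.Basis s ℤ A) := by
    by_contra hbasis
    simp [LinearMap.trace, hbasis] at htr
  obtain ⟨s, ⟨b⟩⟩ := hbasis
  have : Module.Free ℤ A := Module.Free.of_basis b
  have : Module.Finite ℤ A := Module.Finite.of_basis b
  have hdet : IsUnit (LinearMap.det e) :=
    LinearEquiv.isUnit_det' (LinearEquiv.ofBijective e
      (OrzechProperty.bijective_of_surjective_endomorphism e he))
  let β := Module.finBasis ℤ A
  rw [Module.End.hasEigenvalue_iff_isRoot_charpoly, ← LinearMap.charpoly_toMatrix e β]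
  rw [← LinearMap.det_toMatrix β] at hdet
  rw [LinearMap.trace_eq_matrix_trace ℤ β] at htr
  exact not_isRoot_charpoly_one_of_two_lt_abs_trace hA hdet htr

variable {F : Type*} [Group F]

theorem span_abelianization_eq_top {s : Set F} (hs : Subgroup.closure s = ⊤) :
    Submodule.span ℤ ((fun g => Additive.ofMul (Abelianization.of g)) '' s) = ⊤ := by
  rw [eq_top_iff]
  rintro ⟨g⟩ -
  have hg : g ∈ Subgroup.closure s := hs ▸ Subgroup.mem_top g
  induction hg using Subgroup.closure_induction with
  | mem y hy => exact Submodule.subset_span ⟨y, hy, rfl⟩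
  | one => exact zero_mem _
  | mul y z _ _ hy hz => exact add_mem hy hz
  | inv y _ hy => exact neg_mem hy

theorem finite_abelianization {s : Set F} (hs : Subgroup.closure s = ⊤) (hfin : s.Finite) :
    Module.Finite ℤ (Additive (Abelianization F)) :=
  Module.finite_def.mpr ⟨_, by rw [(hfin.image _).coe_toFinset, span_abelianization_eq_top hs]⟩

theorem finrank_abelianization_le_two {a b : F} (hab : Subgroup.closure {a, b} = ⊤) :
    Module.finrank ℤ (Additive (Abelianization F)) ≤ 2 := by
  classical
  have h := finrank_span_finset_le_card (R := ℤ)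
    (({a, b} : Finset F).image fun g => Additive.ofMul (Abelianization.of g))
  rw [Finset.coe_image, Finset.coe_pair, Set.finrank, span_abelianization_eq_top hab,
    finrank_top] at h
  exact h.trans (Finset.card_image_le.trans Finset.card_le_two)

theorem eq_zero_of_mem_range_of_conj_eq {Γ : Type*} [Group Γ] {f : F →* Γ} {θ : F →* F}
    (hθ : Function.Surjective θ) {t : Γ} (ht : ∀ g, t * f g * t⁻¹ = f (θ g))
    (hinv : ∀ ψ : Additive (Abelianization F) →+ ℝ,
      (∀ v, ψ ((Abelianization.map θ).toAdditive v) = ψ v) → ψ = 0)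
    (Λ : Additive (Subgroup.normalizer (f.range : Set Γ)) →+ ℝ) {g : Γ} (hg : g ∈ f.range) :
    Λ (.ofMul ⟨g, Subgroup.le_normalizer hg⟩) = 0 := by
  have htN : t ∈ Subgroup.normalizer (f.range : Set Γ) := by
    rw [Subgroup.mem_normalizer_iff_map_conj_eq, MonoidHom.map_range]
    have : (MulAut.conj t : Γ →* Γ).comp f = f.comp θ := MonoidHom.ext ht
    rw [this, MonoidHom.range_comp, MonoidHom.range_eq_top.mpr hθ, ← MonoidHom.range_eq_map]
  let ρ : F →* Subgroup.normalizer (f.range : Set Γ) :=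
    (Subgroup.inclusion Subgroup.le_normalizer).comp f.rangeRestrict
  have hρ (k : F) : ρ (θ k) = ⟨t, htN⟩ * ρ k * ⟨t, htN⟩⁻¹ := Subtype.ext (ht k).symm
  let ψ := MonoidHom.toAdditiveLeft
    (Abelianization.lift ((AddMonoidHom.toMultiplicativeRight Λ).comp ρ))
  have hψ : ψ = 0 := hinv ψ <| by
    rintro ⟨k⟩
    change Λ (.ofMul (ρ (θ k))) = Λ (.ofMul (ρ k))
    rw [hρ, ofMul_mul, ofMul_mul, ofMul_inv, map_add, map_add, map_neg]
    abel
  obtain ⟨k, rfl⟩ := hg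
  exact DFunLike.congr_fun hψ (.ofMul (Abelianization.of k))

end Homology

/-! ### Generating fundamental groups by simply connected pieces -/

instance : ContractibleSpace unitInterval :=
  (convex_Icc (0 : ℝ) 1).contractibleSpace ⟨0, by simp⟩

section SegmentLoop

variable {X S R : Type*} [TopologicalSpace X] [TopologicalSpace S] [TopologicalSpace R]
  [SimplyConnectedSpace S] [SimplyConnectedSpace R]

/-- The class of the image under `f` of a path from `u` to `v`. All these paths are homotopic
because `S` is simply connected. -/
noncomputable def transportAlong (f : C(S, X)) (u v : S) :
    FundamentalGroupoid.mk (f u) ⟶ FundamentalGroupoid.mk (f v) :=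
  (FundamentalGroupoid.map f).map (X := .mk u) (Y := .mk v)
    (Path.Homotopic.Quotient.mk (PathConnectedSpace.somePath u v))

theorem transportAlong_eq_map (f : C(S, X)) {u v : S}
    (p : FundamentalGroupoid.mk u ⟶ FundamentalGroupoid.mk v) :
    transportAlong f u v = (FundamentalGroupoid.map f).map p := by
  rw [transportAlong, Subsingleton.elim (α := Path.Homotopic.Quotient u v) p]

theorem transportAlong_trans (f : C(S, X)) (u v w : S) :
    transportAlong f u v ≫ transportAlong f v w = transportAlong f u w :=
  ((transportAlong_eq_map f _).trans ((FundamentalGroupoid.map f).map_comp _ _)).symm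

theorem transportAlong_comp (f : C(S, X)) (g : C(R, S)) (u v : R) :
    transportAlong (f.comp g) u v = transportAlong f (g u) (g v) := by
  let p : FundamentalGroupoid.mk u ⟶ FundamentalGroupoid.mk v :=
    Path.Homotopic.Quotient.mk (PathConnectedSpace.somePath u v)
  rw [transportAlong_eq_map f ((FundamentalGroupoid.map g).map p)]
  exact Path.Homotopic.Quotient.map_comp (p := p)

variable {x : X} (q : ∀ y, FundamentalGroupoid.mk x ⟶ FundamentalGroupoid.mk y)

/-- The loop class at `x` that runs along `q` to `f u`, then along the image of `S` to `f v`, and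
back to `x` along `q`. -/
noncomputable def segmentLoop (f : C(S, X)) (u v : S) : FundamentalGroup X x :=
  q (f u) ≫ transportAlong f u v ≫ inv (q (f v))

theorem segmentLoop_mul (f : C(S, X)) (u v w : S) :
    segmentLoop q f v w * segmentLoop q f u v = segmentLoop q f u w := by
  rw [End.mul_def, segmentLoop, segmentLoop, segmentLoop, ← transportAlong_trans f u v w]
  simp

theorem segmentLoop_self (f : C(S, X)) (u : S) : segmentLoop q f u u = 1 :=
  mul_eq_left.mp (segmentLoop_mul q f u u u)

theorem segmentLoop_inv (f : C(S, X)) (u v : S) :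
    (segmentLoop q f u v)⁻¹ = segmentLoop q f v u := by
  rw [inv_eq_iff_mul_eq_one, segmentLoop_mul, segmentLoop_self]

theorem segmentLoop_comp (f : C(S, X)) (g : C(R, S)) (u v : R) :
    segmentLoop q (f.comp g) u v = segmentLoop q f (g u) (g v) := by
  rw [segmentLoop, transportAlong_comp]
  rfl

theorem segmentLoop_path {y z : X} (γ : Path y z) :
    segmentLoop q γ.toContinuousMap 0 1 = q y ≫ Path.Homotopic.Quotient.mk γ ≫ inv (q z) := by
  obtain ⟨f, rfl, rfl⟩ := γ
  let p : Path (0 : unitInterval) 1 := ⟨ContinuousMap.id _, rfl, rfl⟩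
  rw [segmentLoop, transportAlong_eq_map f (Path.Homotopic.Quotient.mk p)]
  rfl

theorem exists_segmentLoop_eq_one {f : C(S, X)} (hf : Function.Bijective f) (x : X) :
    ∃ q : ∀ y, FundamentalGroupoid.mk x ⟶ FundamentalGroupoid.mk y,
      q x = 𝟙 _ ∧ ∀ u v, segmentLoop q f u v = 1 := by
  obtain ⟨s, rfl⟩ := hf.2 x
  have hq (y : X) : ∃ p : FundamentalGroupoid.mk (f s) ⟶ FundamentalGroupoid.mk y,
      ∀ u (hu : f u = y), p = transportAlong f s u ≫ eqToHom (congrArg _ hu) := by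
    obtain ⟨u, rfl⟩ := hf.2 y
    refine ⟨transportAlong f s u, fun v hv => ?_⟩
    obtain rfl := hf.1 hv
    rw [eqToHom_refl, Category.comp_id]
  choose q hq using hq
  have hq (u : S) : q (f u) = transportAlong f s u := by
    rw [hq _ u rfl, eqToHom_refl, Category.comp_id]
  refine ⟨q, ?_, fun u v => ?_⟩
  · rw [hq, ← cancel_epi (transportAlong f s s), transportAlong_trans, Category.comp_id]
  · rw [segmentLoop, ← Category.assoc, hq u, transportAlong_trans, ← hq v, IsIso.hom_inv_id]
    rfl

variable {q}

theorem segmentLoop_mem_zpowers {f : C(S, X)} {A B : Set S} (hAB : A ∪ B = univ)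
    (hA : ∀ u ∈ A, ∀ v ∈ A, segmentLoop q f u v = 1)
    (hB : ∀ u ∈ B, ∀ v ∈ B, segmentLoop q f u v = 1) {u₀ v₀ : S} (hu₀ : u₀ ∈ A) (hv₀ : v₀ ∈ B)
    (u v : S) : segmentLoop q f u v ∈ Subgroup.zpowers (segmentLoop q f u₀ v₀) := by
  have key (s : S) : segmentLoop q f u₀ s ∈ Subgroup.zpowers (segmentLoop q f u₀ v₀) := by
    rcases hAB ▸ mem_univ s with hs | hs
    · rw [hA u₀ hu₀ s hs]
      exact one_mem _
    · rw [← segmentLoop_mul q f u₀ v₀ s, hB v₀ hv₀ s hs, one_mul]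
      exact Subgroup.mem_zpowers _
  rw [← segmentLoop_mul q f u u₀ v, ← segmentLoop_inv q f u₀ u]
  exact mul_mem (key v) (inv_mem (key u))

theorem segmentLoop_mem_of_eventually {f : C(S, X)} {H : Subgroup (FundamentalGroup X x)}
    (hf : ∀ u, ∀ᶠ v in 𝓝 u, segmentLoop q f u v ∈ H) (u v : S) : segmentLoop q f u v ∈ H := by
  have : Std.Symm fun u v => segmentLoop q f u v ∈ H :=
    ⟨fun u v h => segmentLoop_inv q f u v ▸ inv_mem h⟩
  have htrans : IsTrans S fun u v => segmentLoop q f u v ∈ H :=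
    ⟨fun u v w h h' => segmentLoop_mul q f u v w ▸ mul_mem h' h⟩
  exact PreconnectedSpace.induction₂ _ hf htrans u v

theorem segmentLoop_eq_of_comp_eq {S' : Type*} [TopologicalSpace S'] [SimplyConnectedSpace S']
    {f : C(S, X)} {f' : C(S', X)} {g : C(R, S)} {g' : C(R, S')} (h : ∀ r, f (g r) = f' (g' r))
    (u v : R) : segmentLoop q f (g u) (g v) = segmentLoop q f' (g' u) (g' v) := by
  rw [← segmentLoop_comp, ← segmentLoop_comp, show f.comp g = f'.comp g' from ContinuousMap.ext h]

theorem eventually_segmentLoop_mem {E : Type*} [TopologicalSpace E] {P : Set E}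
    [SimplyConnectedSpace P] {f : C(unitInterval, X)} {g : C(P, X)} {l : C(unitInterval, E)}
    (hfg : ∀ t (ht : l t ∈ P), f t = g ⟨l t, ht⟩) {H : Subgroup (FundamentalGroup X x)}
    (hH : ∀ u v, segmentLoop q g u v ∈ H) {t₀ : unitInterval} (hP : ∀ᶠ t in 𝓝 t₀, l t ∈ P) :
    ∀ᶠ t in 𝓝 t₀, segmentLoop q f t₀ t ∈ H := by
  obtain ⟨ε, hε, hball⟩ := Metric.eventually_nhds_iff.mp hP
  filter_upwards [Metric.ball_mem_nhds t₀ hε] with t ht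
  let J : Set ℝ := Icc 0 1 ∩ Metric.ball (t₀ : ℝ) ε
  have : ContractibleSpace J :=
    ((convex_Icc (0 : ℝ) 1).inter (convex_ball _ _)).contractibleSpace ⟨t, t.2, ht⟩
  let g₁ : C(J, unitInterval) := ⟨fun r => ⟨r.1, r.2.1⟩, by fun_prop⟩
  let g₂ : C(J, P) := ⟨fun r => ⟨l (g₁ r), hball r.2.2⟩, by fun_prop⟩
  have := segmentLoop_eq_of_comp_eq (q := q) (f' := g) (g' := g₂) (fun r => hfg (g₁ r) (g₂ r).2)
    ⟨t₀, t₀.2, Metric.mem_ball_self hε⟩ ⟨t, t.2, ht⟩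
  exact this ▸ hH _ _

end SegmentLoop

/-! ### The fundamental group of the punctured torus -/

theorem quarter_le_norm_coe_iff {s : ℝ} (hs : s ∈ Ico (0 : ℝ) 1) :
    1 / 4 ≤ ‖(s : UnitAddCircle)‖ ↔ s ∈ Icc (1 / 4 : ℝ) (3 / 4) := by
  rw [UnitAddCircle.norm_eq, abs_sub_round_eq_min, Int.fract_eq_self.mpr hs, le_min_iff, mem_Icc]
  constructor <;> rintro ⟨h₁, h₂⟩ <;> constructor <;> linarith

theorem norm_coe_lt_quarter {s : ℝ} (hs : s ∈ Ioo (-1 / 4 : ℝ) (1 / 4)) :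
    ‖(s : UnitAddCircle)‖ < 1 / 4 := by
  rw [UnitAddCircle.norm_eq]
  refine (round_le s 0).trans_lt ?_
  rw [Int.cast_zero, sub_zero, abs_lt]
  exact ⟨by linarith [hs.1], hs.2⟩

theorem exists_lift_apply_mem_Ico {A : Type*} [TopologicalSpace A] [SimplyConnectedSpace A]
    [LocallyPathConnectedSpace A] (f : C(A, UnitAddCircle)) (a : A) :
    ∃ l : C(A, ℝ), (∀ t, (l t : UnitAddCircle) = f t) ∧ l a ∈ Ico (0 : ℝ) 1 := by
  obtain ⟨s, hs, hsa⟩ := AddCircle.coe_image_Ico_eq (1 : ℝ) 0 ▸ mem_univ (f a)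
  obtain ⟨l, ⟨rfl, hl⟩, -⟩ :=
    (AddCircle.isCoveringMap_coe (1 : ℝ)).existsUnique_continuousMap_lifts f a s hsa
  exact ⟨l, congrFun hl, by simpa using hs⟩

namespace PuncturedTorus

/-- The preimage of the punctured torus in the plane `ℝ²` that covers the torus. -/
def coverRegion : Set (ℝ × ℝ) :=
  {e | 1 / 4 ≤ ‖((e.1 : UnitAddCircle), (e.2 : UnitAddCircle))‖}

theorem mem_coverRegion {e : ℝ × ℝ} :
    e ∈ coverRegion ↔ 1 / 4 ≤ ‖(e.1 : UnitAddCircle)‖ ∨ 1 / 4 ≤ ‖(e.2 : UnitAddCircle)‖ := by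
  rw [coverRegion, mem_ofPred_eq, Prod.norm_def, le_max_iff]

theorem mem_coverRegion_iff_of_mem_Ico {e : ℝ × ℝ} (he : e ∈ Ico (0 : ℝ) 1 ×ˢ Ico (0 : ℝ) 1) :
    e ∈ coverRegion ↔ e.1 ∈ Icc (1 / 4 : ℝ) (3 / 4) ∨ e.2 ∈ Icc (1 / 4 : ℝ) (3 / 4) := by
  rw [mem_coverRegion, quarter_le_norm_coe_iff he.1, quarter_le_norm_coe_iff he.2]

/-- The projection of a subset of the plane to the punctured torus. -/
def coverProj {S : Set (ℝ × ℝ)} (hS : S ⊆ coverRegion) : C(S, PuncturedTorus) where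
  toFun e := ⟨((e.1.1 : UnitAddCircle), (e.1.2 : UnitAddCircle)), hS e.2⟩
  continuous_toFun := by
    refine Continuous.subtype_mk (Continuous.prodMk ?_ ?_) _
    · exact (AddCircle.continuous_mk' 1).comp (continuous_fst.comp continuous_subtype_val)
    · exact (AddCircle.continuous_mk' 1).comp (continuous_snd.comp continuous_subtype_val)

/-- The part of the fundamental square `[0, 1)²` that lies over the punctured torus. -/
def fundamentalRegion : Set (ℝ × ℝ) :=
  coverRegion ∩ Ico (0 : ℝ) 1 ×ˢ Ico (0 : ℝ) 1

theorem fundamentalRegion_subset : fundamentalRegion ⊆ coverRegion := inter_subset_left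

/-- A strip of the cover around the edge `s = 0` of the fundamental square. -/
def verticalStrip : Set (ℝ × ℝ) := Ioo (-1 / 4 : ℝ) (1 / 4) ×ˢ Icc (1 / 4 : ℝ) (3 / 4)

/-- A strip of the cover around the edge `t = 0` of the fundamental square. -/
def horizontalStrip : Set (ℝ × ℝ) := Icc (1 / 4 : ℝ) (3 / 4) ×ˢ Ioo (-1 / 4 : ℝ) (1 / 4)

theorem Icc_quarter_subset_Ico : Icc (1 / 4 : ℝ) (3 / 4) ⊆ Ico (0 : ℝ) 1 :=
  Icc_subset_Ico_iff (by norm_num) |>.mpr ⟨by norm_num, by norm_num⟩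

theorem verticalStrip_subset : verticalStrip ⊆ coverRegion := fun _ he =>
  mem_coverRegion.mpr (Or.inr ((quarter_le_norm_coe_iff (Icc_quarter_subset_Ico he.2)).mpr he.2))

theorem horizontalStrip_subset : horizontalStrip ⊆ coverRegion := fun _ he =>
  mem_coverRegion.mpr (Or.inl ((quarter_le_norm_coe_iff (Icc_quarter_subset_Ico he.1)).mpr he.1))

theorem fundamentalRegion_eq : fundamentalRegion = Ico (0 : ℝ) 1 ×ˢ Ico (0 : ℝ) 1 ∩
    (Icc (1 / 4 : ℝ) (3 / 4) ×ˢ univ ∪ univ ×ˢ Icc (1 / 4 : ℝ) (3 / 4)) := by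
  ext e
  simp only [fundamentalRegion, mem_inter_iff, and_comm (a := e ∈ coverRegion)]
  exact and_congr_right fun he => by simp [mem_coverRegion_iff_of_mem_Ico he]

instance : SimplyConnectedSpace fundamentalRegion := by
  have hstar : StarConvex ℝ ((1 / 2 : ℝ), (1 / 2 : ℝ)) fundamentalRegion := by
    rw [fundamentalRegion_eq]
    refine (((convex_Ico _ _).prod (convex_Ico _ _)).starConvex ?_).inter
      ((((convex_Icc _ _).prod convex_univ).starConvex ?_).union
        ((convex_univ.prod (convex_Icc _ _)).starConvex ?_)) <;> norm_num
  have := hstar.contractibleSpace ⟨(1 / 2, 1 / 2), by norm_num [fundamentalRegion_eq]⟩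
  infer_instance

theorem convex_verticalStrip : Convex ℝ verticalStrip := (convex_Ioo _ _).prod (convex_Icc _ _)

theorem convex_horizontalStrip : Convex ℝ horizontalStrip := (convex_Icc _ _).prod (convex_Ioo _ _)

instance : SimplyConnectedSpace verticalStrip :=
  have := convex_verticalStrip.contractibleSpace ⟨(0, 1 / 2), by norm_num [verticalStrip]⟩
  inferInstance

instance : SimplyConnectedSpace horizontalStrip :=
  have := convex_horizontalStrip.contractibleSpace ⟨(1 / 2, 0), by norm_num [horizontalStrip]⟩
  inferInstance

theorem bijective_coverProj_fundamentalRegion :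
    Function.Bijective (coverProj fundamentalRegion_subset) := by
  constructor
  · rintro ⟨⟨s, t⟩, hst, hs, ht⟩ ⟨⟨s', t'⟩, hst', hs', ht'⟩ h
    obtain ⟨h₁, h₂⟩ := Prod.ext_iff.mp (congrArg Subtype.val h)
    refine Subtype.ext (Prod.ext ?_ ?_)
    · exact (AddCircle.coe_eq_coe_iff_of_mem_Ico (a := 0) (by simpa using hs)
        (by simpa using hs')).mp h₁
    · exact (AddCircle.coe_eq_coe_iff_of_mem_Ico (a := 0) (by simpa using ht)
        (by simpa using ht')).mp h₂
  · rintro ⟨⟨y, z⟩, h⟩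
    obtain ⟨s, hs, rfl⟩ := AddCircle.coe_image_Ico_eq (1 : ℝ) 0 ▸ mem_univ y
    obtain ⟨t, ht, rfl⟩ := AddCircle.coe_image_Ico_eq (1 : ℝ) 0 ▸ mem_univ z
    exact ⟨⟨(s, t), h, by simpa using hs, by simpa using ht⟩, rfl⟩

theorem fundamentalRegion_mem_nhdsWithin {e : ℝ × ℝ} (he : e ∈ Ioo (0 : ℝ) 1 ×ˢ Ioo (0 : ℝ) 1) :
    fundamentalRegion ∈ 𝓝[coverRegion] e := by
  filter_upwards [self_mem_nhdsWithin,
    mem_nhdsWithin_of_mem_nhds ((isOpen_Ioo.prod isOpen_Ioo).mem_nhds he)] with d hd hd'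
  exact ⟨hd, Ioo_subset_Ico_self hd'.1, Ioo_subset_Ico_self hd'.2⟩

theorem verticalStrip_mem_nhdsWithin {e : ℝ × ℝ}
    (he : e ∈ Ioo (-1 / 4 : ℝ) (1 / 4) ×ˢ Ioo (0 : ℝ) 1) :
    verticalStrip ∈ 𝓝[coverRegion] e := by
  filter_upwards [self_mem_nhdsWithin,
    mem_nhdsWithin_of_mem_nhds ((isOpen_Ioo.prod isOpen_Ioo).mem_nhds he)] with d hd hd'
  refine ⟨hd'.1, (quarter_le_norm_coe_iff (Ioo_subset_Ico_self hd'.2)).mp ?_⟩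
  exact (mem_coverRegion.mp hd).resolve_left (norm_coe_lt_quarter hd'.1).not_ge

theorem horizontalStrip_mem_nhdsWithin {e : ℝ × ℝ}
    (he : e ∈ Ioo (0 : ℝ) 1 ×ˢ Ioo (-1 / 4 : ℝ) (1 / 4)) :
    horizontalStrip ∈ 𝓝[coverRegion] e := by
  filter_upwards [self_mem_nhdsWithin,
    mem_nhdsWithin_of_mem_nhds ((isOpen_Ioo.prod isOpen_Ioo).mem_nhds he)] with d hd hd'
  refine ⟨(quarter_le_norm_coe_iff (Ioo_subset_Ico_self hd'.1)).mp ?_, hd'.2⟩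
  exact (mem_coverRegion.mp hd).resolve_right (norm_coe_lt_quarter hd'.2).not_ge

theorem mem_nhdsWithin_coverRegion_cases {e : ℝ × ℝ} (he : e ∈ fundamentalRegion) :
    fundamentalRegion ∈ 𝓝[coverRegion] e ∨ verticalStrip ∈ 𝓝[coverRegion] e ∨
      horizontalStrip ∈ 𝓝[coverRegion] e := by
  obtain ⟨s, t⟩ := e
  have hregion := (mem_coverRegion_iff_of_mem_Ico he.2).mp he.1
  obtain ⟨-, ⟨hs₀, hs₁⟩, ht₀, ht₁⟩ := he
  simp only at hregion hs₀ hs₁ ht₀ ht₁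
  rcases hs₀.eq_or_lt with rfl | hs₀
  · have ht : t ≠ 0 := by rintro rfl; norm_num at hregion
    exact .inr (.inl (verticalStrip_mem_nhdsWithin
      ⟨by norm_num, lt_of_le_of_ne ht₀ ht.symm, ht₁⟩))
  · rcases ht₀.eq_or_lt with rfl | ht₀
    · exact .inr (.inr (horizontalStrip_mem_nhdsWithin ⟨⟨hs₀, hs₁⟩, by norm_num⟩))
    · exact .inl (fundamentalRegion_mem_nhdsWithin ⟨⟨hs₀, hs₁⟩, ht₀, ht₁⟩)

theorem exists_lift_apply_mem_fundamentalRegion {A : Type*} [TopologicalSpace A]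
    [SimplyConnectedSpace A] [LocallyPathConnectedSpace A] (f : C(A, PuncturedTorus)) (a : A) :
    ∃ l : C(A, coverRegion),
      (∀ t, coverProj subset_rfl (l t) = f t) ∧ (l a : ℝ × ℝ) ∈ fundamentalRegion := by
  obtain ⟨l₁, hl₁, ha₁⟩ := exists_lift_apply_mem_Ico ⟨fun t => (f t).1.1, by fun_prop⟩ a
  obtain ⟨l₂, hl₂, ha₂⟩ := exists_lift_apply_mem_Ico ⟨fun t => (f t).1.2, by fun_prop⟩ a
  have hl (t : A) : ((l₁ t : UnitAddCircle), (l₂ t : UnitAddCircle)) = (f t).1 :=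
    Prod.ext (hl₁ t) (hl₂ t)
  have hmem (t : A) : (l₁ t, l₂ t) ∈ coverRegion := by
    rw [coverRegion, mem_ofPred_eq, hl t]
    exact (f t).2
  exact ⟨⟨fun t => ⟨(l₁ t, l₂ t), hmem t⟩, by fun_prop⟩, fun t => Subtype.ext (hl t),
    hmem a, ha₁, ha₂⟩

variable {x : PuncturedTorus} {q : ∀ y, FundamentalGroupoid.mk x ⟶ FundamentalGroupoid.mk y}

theorem segmentLoop_coverProj_eq_one
    (hq : ∀ u v, segmentLoop q (coverProj fundamentalRegion_subset) u v = 1)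
    {S : Set (ℝ × ℝ)} [SimplyConnectedSpace S] (hS : S ⊆ coverRegion) {P : Set (ℝ × ℝ)}
    (hP : Convex ℝ P) (hPS : P ⊆ S) (m n : ℤ)
    (hmem : ∀ e ∈ P, e + ((m : ℝ), (n : ℝ)) ∈ fundamentalRegion) {u v : S} (hu : ↑u ∈ P)
    (hv : ↑v ∈ P) : segmentLoop q (coverProj hS) u v = 1 := by
  have := hP.contractibleSpace ⟨u, hu⟩
  let i : C(P, S) := ⟨inclusion hPS, continuous_inclusion hPS⟩
  let j : C(P, fundamentalRegion) := ⟨fun e => ⟨_, hmem e e.2⟩, by fun_prop⟩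
  have hij (e : P) : coverProj hS (i e) = coverProj fundamentalRegion_subset (j e) :=
    Subtype.ext (Prod.ext (by simp [coverProj, i, j]) (by simp [coverProj, i, j]))
  exact (segmentLoop_eq_of_comp_eq hij ⟨u, hu⟩ ⟨v, hv⟩).trans (hq _ _)

theorem segmentLoop_mem_zpowers_of_halfPlanes
    (hq : ∀ u v, segmentLoop q (coverProj fundamentalRegion_subset) u v = 1)
    {S : Set (ℝ × ℝ)} [SimplyConnectedSpace S] (hS : S ⊆ coverRegion) (hconv : Convex ℝ S)
    (L : ℝ × ℝ →ₗ[ℝ] ℝ) (m n : ℤ) (hpos : ∀ e ∈ S, 0 ≤ L e → e ∈ fundamentalRegion)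
    (hneg : ∀ e ∈ S, L e < 0 → e + ((m : ℝ), (n : ℝ)) ∈ fundamentalRegion) {u₀ v₀ : S}
    (hu₀ : 0 ≤ L u₀) (hv₀ : L v₀ < 0) (u v : S) :
    segmentLoop q (coverProj hS) u v ∈ Subgroup.zpowers (segmentLoop q (coverProj hS) u₀ v₀) := by
  refine segmentLoop_mem_zpowers (A := {e : S | 0 ≤ L e}) (B := {e : S | L e < 0})
    (eq_univ_of_forall fun e => le_or_gt 0 (L e)) (fun u hu v hv => ?_) (fun u hu v hv => ?_)
    hu₀ hv₀ u v
  · exact segmentLoop_coverProj_eq_one hq hS (hconv.inter (convex_halfSpace_ge L.isLinear 0))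
      inter_subset_left 0 0 (fun e he => by simpa [Prod.mk_zero_zero] using hpos e he.1 he.2)
      ⟨u.2, hu⟩ ⟨v.2, hv⟩
  · exact segmentLoop_coverProj_eq_one hq hS (hconv.inter (convex_halfSpace_lt L.isLinear 0))
      inter_subset_left m n (fun e he => hneg e he.1 he.2) ⟨u.2, hu⟩ ⟨v.2, hv⟩

theorem exists_segmentLoop_verticalStrip_mem_zpowers
    (hq : ∀ u v, segmentLoop q (coverProj fundamentalRegion_subset) u v = 1) :
    ∃ a, ∀ u v, segmentLoop q (coverProj verticalStrip_subset) u v ∈ Subgroup.zpowers a := by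
  refine ⟨_, segmentLoop_mem_zpowers_of_halfPlanes hq verticalStrip_subset convex_verticalStrip
    (LinearMap.fst ℝ ℝ ℝ) 1 0 (fun e he hpos => ?_) (fun e he hneg => ?_)
    (u₀ := ⟨(0, 1 / 2), by norm_num [verticalStrip]⟩)
    (v₀ := ⟨(-1 / 8, 1 / 2), by norm_num [verticalStrip]⟩) (by simp) (by norm_num)⟩
  · exact ⟨verticalStrip_subset he, ⟨hpos, by linarith [he.1.2]⟩, Icc_quarter_subset_Ico he.2⟩
  · obtain ⟨s, t⟩ := e
    have hs : s + 1 ∈ Ico (0 : ℝ) 1 := ⟨by linarith [he.1.1], by linarith [show s < 0 from hneg]⟩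
    have hst : (s + 1, t) ∈ fundamentalRegion :=
      fundamentalRegion_eq ▸ ⟨⟨hs, Icc_quarter_subset_Ico he.2⟩, .inr ⟨trivial, he.2⟩⟩
    simpa using hst

theorem exists_segmentLoop_horizontalStrip_mem_zpowers
    (hq : ∀ u v, segmentLoop q (coverProj fundamentalRegion_subset) u v = 1) :
    ∃ a, ∀ u v, segmentLoop q (coverProj horizontalStrip_subset) u v ∈ Subgroup.zpowers a := by
  refine ⟨_, segmentLoop_mem_zpowers_of_halfPlanes hq horizontalStrip_subset convex_horizontalStrip
    (LinearMap.snd ℝ ℝ ℝ) 0 1 (fun e he hpos => ?_) (fun e he hneg => ?_)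
    (u₀ := ⟨(1 / 2, 0), by norm_num [horizontalStrip]⟩)
    (v₀ := ⟨(1 / 2, -1 / 8), by norm_num [horizontalStrip]⟩) (by simp) (by norm_num)⟩
  · exact ⟨horizontalStrip_subset he, Icc_quarter_subset_Ico he.1, ⟨hpos, by linarith [he.2.2]⟩⟩
  · obtain ⟨s, t⟩ := e
    have ht : t + 1 ∈ Ico (0 : ℝ) 1 := ⟨by linarith [he.2.1], by linarith [show t < 0 from hneg]⟩
    have hst : (s, t + 1) ∈ fundamentalRegion :=
      fundamentalRegion_eq ▸ ⟨⟨Icc_quarter_subset_Ico he.1, ht⟩, .inl ⟨he.1, trivial⟩⟩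
    simpa using hst

theorem exists_closure_pair_eq_top (x : PuncturedTorus) :
    ∃ a b : FundamentalGroup PuncturedTorus x, Subgroup.closure {a, b} = ⊤ := by
  obtain ⟨q, hqx, hq⟩ := exists_segmentLoop_eq_one bijective_coverProj_fundamentalRegion x
  obtain ⟨a, ha⟩ := exists_segmentLoop_verticalStrip_mem_zpowers hq
  obtain ⟨b, hb⟩ := exists_segmentLoop_horizontalStrip_mem_zpowers hq
  refine ⟨a, b, (Subgroup.eq_top_iff' _).mpr fun p => ?_⟩
  have ha' : Subgroup.zpowers a ≤ Subgroup.closure {a, b} := by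
    simpa using Subgroup.subset_closure (mem_insert a {b})
  have hb' : Subgroup.zpowers b ≤ Subgroup.closure {a, b} := by
    simpa using Subgroup.subset_closure (mem_insert_of_mem a (mem_singleton b))
  obtain ⟨γ, rfl⟩ := Path.Homotopic.Quotient.mk_surjective p
  have hγ : segmentLoop q γ.toContinuousMap 0 1 = Path.Homotopic.Quotient.mk γ := by
    rw [segmentLoop_path, hqx, IsIso.inv_id, Category.comp_id, Category.id_comp]
  rw [← hγ]
  have : LocallyPathConnectedSpace unitInterval := (convex_Icc (0 : ℝ) 1).locallyPathConnectedSpace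
  refine segmentLoop_mem_of_eventually (fun t₀ => ?_) 0 1
  obtain ⟨l, hl, hl₀⟩ := exists_lift_apply_mem_fundamentalRegion γ.toContinuousMap t₀
  let l' : C(unitInterval, ℝ × ℝ) := ⟨fun t => l t, by fun_prop⟩
  have hmem {S : Set (ℝ × ℝ)} (hS : S ∈ 𝓝[coverRegion] (l t₀ : ℝ × ℝ)) :
      ∀ᶠ t in 𝓝 t₀, l' t ∈ S :=
    l.continuous.continuousAt (preimage_coe_mem_nhds_subtype.mpr hS)
  rcases mem_nhdsWithin_coverRegion_cases hl₀ with hS | hS | hS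
  · exact eventually_segmentLoop_mem (g := coverProj fundamentalRegion_subset)
      (fun t _ => (hl t).symm) (fun u v => hq u v ▸ one_mem _) (hmem hS)
  · exact eventually_segmentLoop_mem (g := coverProj verticalStrip_subset)
      (fun t _ => (hl t).symm) (fun u v => ha' (ha u v)) (hmem hS)
  · exact eventually_segmentLoop_mem (g := coverProj horizontalStrip_subset)
      (fun t _ => (hl t).symm) (fun u v => hb' (hb u v)) (hmem hS)

end PuncturedTorus

/-! ### The monodromy -/

section Monodromy

variable {X Y : Type*} [TopologicalSpace X] [TopologicalSpace Y]

theorem map_comp_eqToHom (f : C(X, Y)) {x : X} {y : Y} (h : f x = y) (g : FundamentalGroup X x) :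
    (FundamentalGroup.map f x g).toArrow ≫ eqToHom (congrArg FundamentalGroupoid.mk h) =
      eqToHom (congrArg FundamentalGroupoid.mk h) ≫ (FundamentalGroup.mapOfEq f h g).toArrow := by
  subst h
  rw [FundamentalGroup.mapOfEq_apply, Path.Homotopic.Quotient.cast_rfl_rfl, eqToHom_refl,
    Category.comp_id, Category.id_comp]
  rfl

theorem exists_conj_map_eq_map_mapOfEq {ι : C(X, Y)} {θ : C(X, X)} (H : ι.Homotopy (ι.comp θ))
    {x : X} (hx : θ x = x) : ∃ t : FundamentalGroup Y (ι x), ∀ g : FundamentalGroup X x,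
      t * FundamentalGroup.map ι x g * t⁻¹ =
        FundamentalGroup.map ι x (FundamentalGroup.mapOfEq θ hx g) := by
  let η := FundamentalGroupoidFunctor.homotopicMapsNatIso H
  let F := FundamentalGroupoid.map ι
  let c : FundamentalGroupoid.mk (ι (θ x)) ⟶ FundamentalGroupoid.mk (ι x) :=
    F.map (eqToHom (congrArg FundamentalGroupoid.mk hx))
  let t : FundamentalGroup Y (ι x) := η.app (FundamentalGroupoid.mk x) ≫ c
  refine ⟨t, fun g => mul_inv_eq_iff_eq_mul.mpr ?_⟩
  have hη : F.map g ≫ η.app (.mk x) =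
      η.app (.mk x) ≫ F.map ((FundamentalGroupoid.map θ).map g) :=
    (η.naturality g).trans (congrArg _ (Path.Homotopic.Quotient.map_comp (p := g)))
  have hc : F.map ((FundamentalGroupoid.map θ).map g) ≫ c =
      c ≫ F.map (FundamentalGroup.mapOfEq θ hx g).toArrow :=
    (F.map_comp _ _).symm.trans ((congrArg F.map (map_comp_eqToHom θ hx g)).trans (F.map_comp _ _))
  exact (CommSq.vert_comp ⟨hη⟩ ⟨hc⟩).w

theorem mapOfEq_surjective (h : X ≃ₜ Y) {x : X} {y : Y} (hx : h x = y) :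
    Function.Surjective (FundamentalGroup.mapOfEq (h : C(X, Y)) hx) := by
  subst hx
  intro g
  obtain ⟨γ, rfl⟩ := Path.Homotopic.Quotient.mk_surjective g
  refine ⟨FundamentalGroup.mapOfEq (h.symm : C(Y, X)) (h.symm_apply_apply x)
    (Path.Homotopic.Quotient.mk γ), ?_⟩
  rw [FundamentalGroup.mapOfEq_apply, FundamentalGroup.mapOfEq_apply]
  exact congrArg Path.Homotopic.Quotient.mk (Path.ext (funext fun t => h.apply_symm_apply (γ t)))

end Monodromy

/-- Flowing once around the base circle, as a homotopy from the inclusion of the fibre to its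
composite with the monodromy. -/
def fibreHomotopy (h : PuncturedTorus ≃ₜ PuncturedTorus) :
    (fibreInclusion h).Homotopy
      ((fibreInclusion h).comp (h : C(PuncturedTorus, PuncturedTorus))) where
  toFun z := Quot.mk _ (z.2, z.1)
  continuous_toFun := continuous_quot_mk.comp (by fun_prop)
  map_zero_left _ := rfl
  map_one_left _ := Quot.sound ⟨rfl, rfl⟩

theorem homologyMap_surjective (h : PuncturedTorus ≃ₜ PuncturedTorus) {x : PuncturedTorus}
    (hx : h x = x) : Function.Surjective (homologyMap h hx) := by
  intro v
  obtain ⟨g, hg⟩ := QuotientGroup.mk_surjective v.toMul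
  obtain ⟨k, rfl⟩ := mapOfEq_surjective h hx g
  exact ⟨.ofMul (Abelianization.of k), hg⟩

theorem IsHyperbolicMonodromy.not_hasEigenvalue_one {h : PuncturedTorus ≃ₜ PuncturedTorus}
    {x : PuncturedTorus} {hx : h x = x} (hyp : IsHyperbolicMonodromy h hx) :
    ¬ Module.End.HasEigenvalue (homologyMap h hx) 1 := by
  obtain ⟨a, b, hab⟩ := PuncturedTorus.exists_closure_pair_eq_top x
  exact not_hasEigenvalue_one_of_two_lt_abs_trace (finrank_abelianization_le_two hab)
    (homologyMap_surjective h hx) hyp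

theorem theorem1p3_general (h : PuncturedTorus ≃ₜ PuncturedTorus) (x : PuncturedTorus)
    (hx : h x = x) (heigen : ¬ Module.End.HasEigenvalue (homologyMap h hx) 1)
    (lt : FundamentalGroup (PuncturedTorusBundle h) (fibreInclusion h x) →
      FundamentalGroup (PuncturedTorusBundle h) (fibreInclusion h x) → Prop)
    (hlt : IsBiOrder lt)
    (C : Subgroup ↥⁅fibreGroup h x, fibreGroup h x⁆)
    (hC : IsMaximalConvexSubgroup (inducedOrder lt ⁅fibreGroup h x, fibreGroup h x⁆) C) :
    C.map (Subgroup.subtype ⁅fibreGroup h x, fibreGroup h x⁆) =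
      ⁅⁅fibreGroup h x, fibreGroup h x⁆, fibreGroup h x⁆ := by
  let f := FundamentalGroup.map (fibreInclusion h) x
  obtain ⟨a, b, hab⟩ := PuncturedTorus.exists_closure_pair_eq_top x
  obtain ⟨t, ht⟩ := exists_conj_map_eq_map_mapOfEq (fibreHomotopy h) hx
  have hgen : Subgroup.closure {f a, f b} = fibreGroup h x := by
    rw [← image_pair, ← MonoidHom.map_closure, hab, ← MonoidHom.range_eq_map, fibreGroup]
  have hfinite := finite_abelianization hab (toFinite _)
  refine hC.map_subtype_eq_commutator hlt hgen fun Λ g hg => ?_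
  exact eq_zero_of_mem_range_of_conj_eq (mapOfEq_surjective h hx) ht
    (fun ψ hψ => eq_zero_of_comp_eq_self heigen hψ) Λ hg

/-- `M` is the untwisted punctured torus bundle with hyperbolic monodromy `h`, `G` is the
fundamental group of the fibre inside `π₁(M)`, and `C` is a maximal convex subgroup of
`G₂ = [G, G]` for the order induced by a bi-order of `π₁(M)`. Then `C = G₃ = [[G, G], G]`. -/
theorem theorem1p3
    (h : PuncturedTorus ≃ₜ PuncturedTorus)
    (hfix : ∀ p ∈ PuncturedTorus.boundary, h p = p)
    (x : PuncturedTorus) (hx : x ∈ PuncturedTorus.boundary)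
    (hyp : IsHyperbolicMonodromy h (hfix x hx))
    (lt : FundamentalGroup (PuncturedTorusBundle h) (fibreInclusion h x) →
      FundamentalGroup (PuncturedTorusBundle h) (fibreInclusion h x) → Prop)
    (hlt : IsBiOrder lt)
    (C : Subgroup ↥⁅fibreGroup h x, fibreGroup h x⁆)
    (hC : IsMaximalConvexSubgroup (inducedOrder lt ⁅fibreGroup h x, fibreGroup h x⁆) C) :
    C.map (Subgroup.subtype ⁅fibreGroup h x, fibreGroup h x⁆) =
      ⁅⁅fibreGroup h x, fibreGroup h x⁆, fibreGroup h x⁆ :=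
  theorem1p3_general h x (hfix x hx) hyp.not_hasEigenvalue_one lt hlt C hC
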